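/- **Model.** Fix $K$ groups, a probability vector $(p_1,\dots,p_K)$ with $p_k\in[0,1)$ for every $k$, a number $q\in(0,1]$, and $n_0\ge K$. The network $G_0$ has $n_0$ isolated nodes, each counted with degree one, of which exactly $p_kn_0$ (an integer) belong to group $k$; write $g_i$ for the group of node $i$ and $d_i(t)$ for its degree in $G_t$. Given $G_{t-1}$, independently with probability $q$ a *vertex-step* is made: a new node $w$ arrives, which belongs to group $k$ with probability $p_k$. Otherwise an *edge-step* is made: $w$ is an old node chosen with probability $d_w(t-1)/\sum_i d_i(t-1)$. In both cases $w$ is then joined by a new edge to an old node $u$ found as follows, with parameters $\alpha,\gamma\in(0,1]$. First an old node $u_1$ is proposed with probability $d_{u_1}(t-1)/\sum_i d_i(t-1)$; it is accepted if $g_{u_1}=g_w$, and otherwise it is accepted with probability $\gamma$. If it is rejected, further proposals are made independently until one is accepted: with probability $\alpha$ a node of the group of $w$ is proposed, chosen with probability $d_u(t-1)/\sum_{g_i=g_w}d_i(t-1)$, and accepted; with probability $1-\alpha$ a node of another group is proposed, chosen with probability $d_u(t-1)/\sum_{g_i\ne g_w}d_i(t-1)$, and accepted with probability $\gamma$. (In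 an edge-step $u=w$ is allowed; such a loop adds two to the degree.) The homophily parameter is $\theta=\frac{\gamma}{\gamma+\alpha(1-\gamma)}\in(0,1]$. **Change point.** Let $c_0\in(0,1)$, and let $(\alpha_1,\gamma_1)$, $(\alpha_2,\gamma_2)$ have homophily parameters $\theta_1^*\neq\theta_2^*$. For $T\in\mathbb N$ and an integer $\tau^*\in[c_0T,(1-c_0)T]$, let $\mathbb P_{T,\tau^*}$ be the law of $(G_0,\dots,G_T)$ when steps $t\le\tau^*$ use $(\alpha_1,\gamma_1)$ and steps $t>\tau^*$ use $(\alpha_2,\gamma_2)$, with $p$ and $q$ unchanged. **Estimator.** Let $v_t=1$ if step $t$ is a vertex-step and $v_t=0$ otherwise, let $(w,u)$ denote the edge added at time $t$, let $D_t^k=\sum_{g_i=k}d_i(t)$ and $P_t^k=\frac{D_{t-1}^k}{2(t-1)+n_0}$, and for $0\le a\le b\le T$ put $$\begin{aligned}\ell_{a,b}(\theta)=\sum_{t=a+1}^{b}\sum_{k=1}^K\Big[&\mathbf 1_{\{v_t=1,\,g_w=g_u=k\}}\log\big(P_t^k+(1-\theta)(1-P_t^k)\big)+\mathbf 1_{\{v_t=1,\,g_w=k,\,g_u\ne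 k\}}\log\big((1-P_t^k)\theta\big)\\&+\mathbf 1_{\{v_t=0,\,g_w=g_u=k\}}\log\big(P_t^k(P_t^k+(1-\theta)(1-P_t^k))\big)+\mathbf 1_{\{v_t=0,\,g_w=k,\,g_u\ne k\}}\log\big(P_t^k(1-P_t^k)\theta\big)\Big].\end{aligned}$$ Let $\hat\tau=\hat\tau_T(G_0,\dots,G_T)$ be any maximizer, over the integers $\tau\in[c_0T,(1-c_0)T]$, of $$\sup_{\theta_1\in(0,1]}\ell_{0,\tau}(\theta_1)+\sup_{\theta_2\in(0,1]}\ell_{\tau,T}(\theta_2).$$ **Theorem.** $|\hat\tau-\tau^*|/T\to0$ in probability as $T\to\infty$, for every choice of $\tau^*=\tau^*_T\in[c_0T,(1-c_0)T]$; equivalently, for every $\varepsilon>0$, $$\lim_{T\to\infty}\ \sup_{\tau^*\in[c_0T,(1-c_0)T]\cap\mathbb Z}\ \mathbb P_{T,\tau^*}\!\left(\frac{|\hat\tau-\tau^*|}{T}>\varepsilon\right)=0 .$$ -/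

import Mathlib

open Filter Topology
open scoped ENNReal

noncomputable section

namespace KPA

/-! ### Two elementary random mechanisms -/

/-- A coin that shows `true` with probability `r` and `false` with probability `1 - r`. -/
def coin (r : ℝ) (h0 : 0 ≤ r) (h1 : r ≤ 1) : PMF Bool :=
  PMF.ofFintype (fun b => if b then ENNReal.ofReal r else ENNReal.ofReal (1 - r)) (by
    have h : ENNReal.ofReal r + ENNReal.ofReal (1 - r) = 1 := by
      rw [← ENNReal.ofReal_add h0 (by linarith)]
      simp
    simpa [Fintype.sum_bool] using h)

/-- Independent trials with law `a` are repeated until the first one that is not rejected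
(`none` means "rejected"); the result is the outcome of that trial. The outcome `u` has probability
`∑ j, P(the first j trials are rejected) * P(a trial gives u)`. -/
def untilAccepted {β : Type*} (a : PMF (Option β)) (h : a none ≠ 1) : PMF β :=
  ⟨fun u => ∑' j : ℕ, a none ^ j * a (some u), by
    rw [ENNReal.summable.hasSum_iff]
    have h1 : a none + ∑' u, a (some u) = 1 := by
      rw [← a.tsum_coe, ENNReal.tsum_eq_add_tsum_ite none]
      congr 1
      have hs : Function.support (fun x : Option β => if x = none then 0 else a x) ⊆
          Set.range some := by
        intro x hx
        cases x with
        | none => simp at hx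
        | some u => exact ⟨u, rfl⟩
      have e := (Option.some_injective β).tsum_eq hs
      simp only [reduceCtorEq, if_false] at e
      exact e.trans (tsum_congr fun x => by cases x <;> simp)
    have h3 : a none ≠ ∞ := a.apply_ne_top none
    have h2 : ∑' u, a (some u) = 1 - a none := by
      rw [← h1]
      exact (ENNReal.add_sub_cancel_left h3).symm
    have h4 : a none < 1 := lt_of_le_of_ne (a.coe_le_one none) h
    simp_rw [ENNReal.tsum_mul_right, ENNReal.tsum_geometric]
    rw [ENNReal.tsum_mul_left, h2]
    exact ENNReal.inv_mul_cancel (tsub_pos_of_lt h4).ne' (ENNReal.sub_ne_top ENNReal.one_ne_top)⟩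

/-! ### Networks -/

/-- A network whose nodes belong to `K` groups, grown from `n₀` initial nodes.
The nodes are numbered in the order of their arrival: the initial ones are `0, …, n₀ - 1`, and
`m` is the number of nodes added so far. `edges` lists the edges added so far, the most recent one
first. -/
structure Graph (K n₀ : ℕ) where
  m : ℕ
  group : Fin (n₀ + m) → Fin K
  edges : List (Fin (n₀ + m) × Fin (n₀ + m))

variable {K n₀ : ℕ}

namespace Graph

/-- The degree of a node: an initial node starts with degree one, and every edge contributes one for
each of its two ends (so a loop contributes two). -/
def degree (G : Graph K n₀) (i : Fin (n₀ + G.m)) : ℕ :=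
  (if (i : ℕ) < n₀ then 1 else 0) + (G.edges.map Prod.fst).count i
    + (G.edges.map Prod.snd).count i

/-- The total degree of the nodes of group `k`. -/
def groupDegree (G : Graph K n₀) (k : Fin K) : ℕ :=
  ∑ i, if G.group i = k then G.degree i else 0

/-- The initial network: `n₀` isolated nodes (of degree one) with group labels `g₀`. -/
def initial (g₀ : Fin n₀ → Fin K) : Graph K n₀ where
  m := 0
  group := g₀
  edges := []

/-- A new node of group `k` arrives and is joined to the old node `u`. -/
def addVertex (G : Graph K n₀) (k : Fin K) (u : Fin (n₀ + G.m)) : Graph K n₀ where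
  m := G.m + 1
  group := Fin.snoc (α := fun _ => Fin K) G.group k
  edges := (Fin.last (n₀ + G.m), u.castSucc) ::
    G.edges.map fun e => (e.1.castSucc, e.2.castSucc)

/-- A new edge is added between the old nodes `w` and `u`. -/
def addEdge (G : Graph K n₀) (w u : Fin (n₀ + G.m)) : Graph K n₀ where
  m := G.m
  group := G.group
  edges := (w, u) :: G.edges

lemma tsum_degree_ne_top (G : Graph K n₀) : ∑' i, (G.degree i : ℝ≥0∞) ≠ ∞ := by
  rw [tsum_fintype]
  exact ENNReal.sum_ne_top.2 fun i _ => ENNReal.natCast_ne_top _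

variable [NeZero n₀]

lemma tsum_degree_ne_zero (G : Graph K n₀) : ∑' i, (G.degree i : ℝ≥0∞) ≠ 0 := by
  rw [ENNReal.summable.tsum_ne_zero_iff]
  refine ⟨⟨0, lt_of_lt_of_le (NeZero.pos n₀) (Nat.le_add_right _ _)⟩, ?_⟩
  have := NeZero.pos n₀
  simp [degree, this]

/-- Preferential attachment: node `u` is chosen with probability `d_u / ∑ i, d_i`. -/
def pick (G : Graph K n₀) : PMF (Fin (n₀ + G.m)) :=
  PMF.normalize (fun i => (G.degree i : ℝ≥0∞)) G.tsum_degree_ne_zero G.tsum_degree_ne_top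

end Graph

/-! ### The model -/

/-- The parameters `α, γ ∈ (0, 1]` that govern homophily: `γ` is the probability of accepting a
proposed connection to a node of another group, and `α` is the probability that, after a first
rejection, a node of the same group is proposed. -/
structure Homophily where
  α : ℝ
  γ : ℝ
  α_pos : 0 < α
  α_le_one : α ≤ 1
  γ_pos : 0 < γ
  γ_le_one : γ ≤ 1

/-- The homophily parameter `θ = γ / (γ + α (1 - γ))`. -/
def Homophily.theta (h : Homophily) : ℝ := h.γ / (h.γ + h.α * (1 - h.γ))

variable [NeZero n₀]

/-- One proposal made after a first rejection, to a node `w` of group `k`.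
With probability `α` a node of group `k` is proposed, node `u` having probability
`d_u / ∑_{g_i = k} d_i`, and accepted. Otherwise a node of another group is proposed, node `u` having
probability `d_u / ∑_{g_i ≠ k} d_i`, and accepted with probability `γ`. The outcome `none` is a
rejection. -/
def proposal (h : Homophily) (G : Graph K n₀) (k : Fin K)
    (hs : ∃ i ∈ {i | G.group i = k}, i ∈ G.pick.support)
    (ho : ∃ i ∈ {i | G.group i ≠ k}, i ∈ G.pick.support) : PMF (Option (Fin (n₀ + G.m))) :=
  (coin h.α h.α_pos.le h.α_le_one).bind fun same =>
    if same then (G.pick.filter {i | G.group i = k} hs).map some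
    else (G.pick.filter {i | G.group i ≠ k} ho).bind fun u =>
      (coin h.γ h.γ_pos.le h.γ_le_one).map fun accept => if accept then some u else none

/-- A proposal is not always rejected. -/
lemma proposal_none_ne_one (h : Homophily) (G : Graph K n₀) (k : Fin K)
    (hs : ∃ i ∈ {i | G.group i = k}, i ∈ G.pick.support)
    (ho : ∃ i ∈ {i | G.group i ≠ k}, i ∈ G.pick.support) :
    proposal h G k hs ho none ≠ 1 := by
  intro h1
  rw [PMF.apply_eq_one_iff] at h1
  obtain ⟨i, hi, hi'⟩ := hs
  have hmem : some i ∈ (proposal h G k ⟨i, hi, hi'⟩ ho).support := by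
    rw [proposal, PMF.mem_support_bind_iff]
    refine ⟨true, ?_, ?_⟩
    · simp [coin, h.α_pos]
    · rw [if_pos rfl, PMF.mem_support_map_iff]
      exact ⟨i, (PMF.mem_support_filter_iff _).2 ⟨hi, hi'⟩, rfl⟩
  rw [h1] at hmem
  simp at hmem

open Classical in
/-- The old node to which a node `w` of group `k` gets connected. First a node `u₁` is proposed
with probability proportional to its degree; it is accepted if it belongs to group `k`, and with
probability `γ` otherwise. After a rejection, proposals are made until one is accepted.
(If there is no old node in group `k`, these proposals are not defined; this never happens with
positive probability in the model, and the value in that case is irrelevant.) -/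
def target (h : Homophily) (G : Graph K n₀) (k : Fin K) : PMF (Fin (n₀ + G.m)) :=
  G.pick.bind fun u₁ =>
    if G.group u₁ = k then PMF.pure u₁
    else (coin h.γ h.γ_pos.le h.γ_le_one).bind fun accept =>
      if accept then PMF.pure u₁
      else if hh : (∃ i ∈ {i | G.group i = k}, i ∈ G.pick.support) ∧
          (∃ i ∈ {i | G.group i ≠ k}, i ∈ G.pick.support) then
        untilAccepted (proposal h G k hh.1 hh.2) (proposal_none_ne_one h G k hh.1 hh.2)
      else PMF.pure u₁

/-- The law of `G_t` given `G_{t-1} = G`: with probability `q` a vertex-step, in which a new node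
arrives, belongs to group `k` with probability `p k`, and gets connected to an old node; otherwise
an edge-step, in which an old node `w`, chosen with probability proportional to its degree, gets
connected to an old node. -/
def step (p : PMF (Fin K)) (q : ℝ) (hq0 : 0 ≤ q) (hq1 : q ≤ 1) (h : Homophily) (G : Graph K n₀) :
    PMF (Graph K n₀) :=
  (coin q hq0 hq1).bind fun v =>
    if v then p.bind fun k => (target h G k).map fun u => G.addVertex k u
    else G.pick.bind fun w => (target h G (G.group w)).map fun u => G.addEdge w u

/-- The law of the network process `(G_0, …, G_T)` with initial groups `g₀`, when the homophily
parameters in force at time `t = 1, 2, …` are `h t`. -/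
def law (p : PMF (Fin K)) (q : ℝ) (hq0 : 0 ≤ q) (hq1 : q ≤ 1) (h : ℕ → Homophily)
    (g₀ : Fin n₀ → Fin K) : (T : ℕ) → PMF (Fin (T + 1) → Graph K n₀)
  | 0 => PMF.pure fun _ => Graph.initial g₀
  | T + 1 => (law p q hq0 hq1 h g₀ T).bind fun G =>
      (step p q hq0 hq1 (h (T + 1)) (G (Fin.last T))).map fun G' =>
        Fin.snoc (α := fun _ => Graph K n₀) G G'

/-- Homophily parameters `h₁` at the times `t ≤ τ` and `h₂` at the times `t > τ`. -/
def changeAt (τ : ℕ) (h₁ h₂ : Homophily) (t : ℕ) : Homophily := if t ≤ τ then h₁ else h₂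

/-! ### The likelihood and the change-point estimator -/

/-- The groups `(g_w, g_u)` of the two ends of the edge `(w, u)` added last. -/
def Graph.lastGroups {K n₀ : ℕ} (G : Graph K n₀) : Option (Fin K × Fin K) :=
  G.edges.head?.map fun e => (G.group e.1, G.group e.2)

open Classical in
/-- The contribution of time `t + 1` to the log-likelihood of `θ`, where `G = G_t` and
`G' = G_{t+1}`. Here `P k = D_t^k / (2 t + n₀)`, the step is a vertex-step if a node has been added,
and `(w, u)` is the new edge. -/
def stepLogLik {K n₀ : ℕ} (θ : ℝ) (t : ℕ) (G G' : Graph K n₀) : ℝ :=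
  let P : Fin K → ℝ := fun k => (G.groupDegree k : ℝ) / (2 * (t : ℝ) + (n₀ : ℝ))
  let vertexStep : Prop := G'.m = G.m + 1
  let same : Fin K → Prop := fun k => G'.lastGroups = some (k, k)
  let different : Fin K → Prop := fun k => ∃ l, l ≠ k ∧ G'.lastGroups = some (k, l)
  (∑ k, if vertexStep ∧ same k then Real.log (P k + (1 - θ) * (1 - P k)) else 0)
    + (∑ k, if vertexStep ∧ different k then Real.log ((1 - P k) * θ) else 0)
    + (∑ k, if ¬ vertexStep ∧ same k then
        Real.log (P k * (P k + (1 - θ) * (1 - P k))) else 0)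
    + (∑ k, if ¬ vertexStep ∧ different k then Real.log (P k * (1 - P k) * θ) else 0)

/-- The log-likelihood of `θ` given the part `(G_a, …, G_b)` of the process, that is, the sum of the
contributions of the times `a + 1, …, b`. -/
def logLik {K n₀ T : ℕ} (θ : ℝ) (G : Fin (T + 1) → Graph K n₀) (a b : ℕ) : ℝ :=
  ∑ t : Fin T, if a ≤ (t : ℕ) ∧ (t : ℕ) < b then
    stepLogLik θ t (G t.castSucc) (G t.succ) else 0

/-- The log-likelihood of the change point `τ`, maximized over the parameters `θ₁, θ₂ ∈ (0, 1]`
before and after the change. -/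
def profileLogLik {K n₀ T : ℕ} (G : Fin (T + 1) → Graph K n₀) (τ : ℕ) : ℝ :=
  (⨆ θ₁ : Set.Ioc (0 : ℝ) 1, logLik θ₁ G 0 τ) + ⨆ θ₂ : Set.Ioc (0 : ℝ) 1, logLik θ₂ G τ T

/-- The times `τ` with `c₀ T ≤ τ ≤ (1 - c₀) T`. -/
def window (c₀ : ℝ) (T : ℕ) : Set ℕ := {τ | c₀ * T ≤ τ ∧ (τ : ℝ) ≤ (1 - c₀) * T}

/-- `τ` is a maximum-likelihood estimate of the change point from the data `G_0, …, G_T`. -/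
def IsChangePointMLE {K n₀ T : ℕ} (c₀ : ℝ) (G : Fin (T + 1) → Graph K n₀) (τ : ℕ) : Prop :=
  τ ∈ window c₀ T ∧ ∀ τ' ∈ window c₀ T, profileLogLik G τ' ≤ profileLogLik G τ

end KPA

end

/-! A Chernoff–Hellinger argument. Given the past, a node of group `k` whose share of the total
degree is `P` connects outside its group with probability `(1 - P) θ` (`expect_target`). So each
step contributes a Bernoulli likelihood times a factor free of `θ`, and that factor cancels in
likelihood ratios.

If a wrong `σ` beats the true `τ`, then some pair of parameters with change at `σ` has likelihood at
least `exp (-2)` times the true one. Hence `e` times the product of the square roots of the one-step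
likelihood ratios is at least 1. To make this uniform in the parameters, `(0, 1]` is cut into `N`
cells, and the ratio is replaced by its upper bound over a cell, `weight`
(`exists_cell_one_le_prod`).

The conditional mean of `weight` is a Hellinger affinity plus a discretization error `√(1/N)`. In a
vertex-step the mean of `1 - P` is at least `1 - max p`, because `∑ p_k P_k ≤ max p` whatever the
shares are. The information per step is therefore bounded below uniformly over the past, and no
limit theorem for the degree shares is needed (`expect_step_weight_le`). Multiplying along the path
(`expect_law_prod_le`) gives `exp (T √(1/N) - C ∑ d_t²)`, where `d_t` is the difference of two step
functions of time with different jumps. By `le_sum_sq_sub_of_jumps`, `∑ d_t²` is at least of order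
`T`.

Markov's inequality and a union bound over at most `T + 1` values of `σ` and `N²` pairs of cells
finish the proof, with `N` large but fixed. -/

namespace PMF

/-! ### Expectations under a probability mass function. -/

variable {α β : Type*}

/-- The expectation of an `ℝ≥0∞`-valued function under a probability mass function. -/
noncomputable def expect (p : PMF α) (f : α → ℝ≥0∞) : ℝ≥0∞ := ∑' x, p x * f x

lemma expect_bind (p : PMF α) (g : α → PMF β) (f : β → ℝ≥0∞) :
    (p.bind g).expect f = p.expect fun x => (g x).expect f := by
  simp only [expect, bind_apply, ← ENNReal.tsum_mul_right, ← ENNReal.tsum_mul_left]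
  rw [ENNReal.tsum_comm]
  simp only [mul_assoc]

lemma expect_pure (x : α) (f : α → ℝ≥0∞) : (PMF.pure x).expect f = f x := by
  rw [expect, tsum_eq_single x]
  · simp
  · intro y hy
    simp [hy]

lemma expect_map (p : PMF α) (g : α → β) (f : β → ℝ≥0∞) :
    (p.map g).expect f = p.expect fun x => f (g x) := by
  rw [← bind_pure_comp, expect_bind]
  simp only [Function.comp, expect_pure]

lemma expect_congr (p : PMF α) {f g : α → ℝ≥0∞} (h : ∀ x ∈ p.support, f x = g x) :
    p.expect f = p.expect g := by
  refine tsum_congr fun x => ?_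
  by_cases hx : p x = 0
  · simp [hx]
  · rw [h x hx]

lemma expect_mono (p : PMF α) {f g : α → ℝ≥0∞} (h : ∀ x ∈ p.support, f x ≤ g x) :
    p.expect f ≤ p.expect g := by
  refine ENNReal.tsum_le_tsum fun x => ?_
  by_cases hx : p x = 0
  · simp [hx]
  · gcongr
    exact h x hx

lemma expect_const (p : PMF α) (c : ℝ≥0∞) : (p.expect fun _ => c) = c := by
  rw [expect, ENNReal.tsum_mul_right, p.tsum_coe, one_mul]

lemma expect_const_mul (p : PMF α) (c : ℝ≥0∞) (f : α → ℝ≥0∞) :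
    (p.expect fun x => c * f x) = c * p.expect f := by
  simp only [expect, ← ENNReal.tsum_mul_left]
  exact tsum_congr fun x => by ring

lemma expect_mul_const (p : PMF α) (c : ℝ≥0∞) (f : α → ℝ≥0∞) :
    (p.expect fun x => f x * c) = p.expect f * c := by
  simp only [mul_comm _ c, expect_const_mul]

lemma expect_finset_sum {ι : Type*} (p : PMF α) (s : Finset ι) (f : ι → α → ℝ≥0∞) :
    (p.expect fun x => ∑ i ∈ s, f i x) = ∑ i ∈ s, p.expect (f i) := by
  simp only [expect, Finset.mul_sum]
  exact Summable.tsum_finsetSum fun _ _ => ENNReal.summable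

lemma expect_ofReal [Fintype α] (p : PMF α) {f : α → ℝ} (hf : ∀ x, 0 ≤ f x) :
    (p.expect fun x => ENNReal.ofReal (f x)) = ENNReal.ofReal (∑ x, (p x).toReal * f x) := by
  rw [expect, tsum_fintype, ENNReal.ofReal_sum_of_nonneg
    fun x _ => mul_nonneg ENNReal.toReal_nonneg (hf x)]
  refine Finset.sum_congr rfl fun x _ => ?_
  rw [ENNReal.ofReal_mul ENNReal.toReal_nonneg, ENNReal.ofReal_toReal (p.apply_ne_top x)]

lemma sum_toReal [Fintype α] (p : PMF α) : ∑ x, (p x).toReal = 1 := by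
  rw [← ENNReal.toReal_sum fun x _ => p.apply_ne_top x, ← tsum_fintype (L := .unconditional α),
    p.tsum_coe,
    ENNReal.toReal_one]

/-- Markov's inequality, for a set that need only be controlled on the support. -/
lemma toOuterMeasure_le_expect (p : PMF α) {s : Set α} {f : α → ℝ≥0∞}
    (h : ∀ x ∈ p.support, x ∈ s → 1 ≤ f x) : p.toOuterMeasure s ≤ p.expect f := by
  rw [toOuterMeasure_apply]
  refine ENNReal.tsum_le_tsum fun x => ?_
  by_cases hx : x ∈ s
  · rw [Set.indicator_of_mem hx]
    by_cases hp : p x = 0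
    · simp [hp]
    · exact le_mul_of_one_le_right' (h x hp hx)
  · simp [hx]

end PMF

/-! ### Expectations for coins and for rejection sampling. -/

namespace KPA

lemma expect_coin (r : ℝ) (h0 : 0 ≤ r) (h1 : r ≤ 1) (f : Bool → ℝ≥0∞) :
    (coin r h0 h1).expect f
      = ENNReal.ofReal r * f true + ENNReal.ofReal (1 - r) * f false := by
  rw [PMF.expect, tsum_fintype, Fintype.sum_bool]
  rfl

lemma expect_filter_of_const {β : Type*} (p : PMF β) (s : Set β) (hs : ∃ i ∈ s, i ∈ p.support)
    {f : β → ℝ≥0∞} {c : ℝ≥0∞} (h : ∀ i ∈ s, f i = c) : (p.filter s hs).expect f = c := by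
  rw [PMF.expect_congr _ (g := fun _ => c), PMF.expect_const]
  intro i hi
  exact h i ((PMF.mem_support_filter_iff hs).1 hi).1

/-- Summing the geometric series over the number of rejections shows that the outcome is one trial
conditioned on acceptance. -/
lemma expect_untilAccepted {β : Type*} (a : PMF (Option β)) (h : a none ≠ 1) (f : β → ℝ≥0∞) :
    (untilAccepted a h).expect f = (1 - a none)⁻¹ * a.expect fun o => o.elim 0 f := by
  have e : ∀ u, untilAccepted a h u = (1 - a none)⁻¹ * a (some u) := fun u => by
    change ∑' j : ℕ, a none ^ j * a (some u) = _
    rw [ENNReal.tsum_mul_right, ENNReal.tsum_geometric]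
  have e2 : (a.expect fun o => o.elim 0 f) = ∑' u, a (some u) * f u := by
    have hs : Function.support (fun o : Option β => a o * o.elim 0 f) ⊆ Set.range some := by
      intro x hx
      cases x with
      | none => simp at hx
      | some u => exact ⟨u, rfl⟩
    exact ((Option.some_injective β).tsum_eq hs).symm
  rw [e2, PMF.expect, ← ENNReal.tsum_mul_left]
  exact tsum_congr fun u => by rw [e, mul_assoc]

variable {K n₀ : ℕ}

/-! ### Degree shares of the groups and preferential attachment. -/

namespace Graph

lemma sum_degree (G : Graph K n₀) : ∑ i, G.degree i = n₀ + 2 * G.edges.length := by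
  have hc : ∀ l : List (Fin (n₀ + G.m)), ∑ i, l.count i = l.length := fun l => by
    have := Multiset.sum_count_eq_card (s := Finset.univ) (m := (l : Multiset (Fin (n₀ + G.m))))
      (by simp)
    simpa using this
  simp only [degree, Finset.sum_add_distrib, hc, List.length_map]
  have : ∑ i : Fin (n₀ + G.m), (if (i : ℕ) < n₀ then 1 else 0) = n₀ := by
    rw [Fin.sum_univ_add]
    simp
  omega

lemma sum_groupDegree (G : Graph K n₀) :
    ∑ k, G.groupDegree k = n₀ + 2 * G.edges.length := by
  rw [← G.sum_degree]
  simp only [groupDegree]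
  rw [Finset.sum_comm]
  simp

lemma degree_castAdd_pos (G : Graph K n₀) (i : Fin n₀) : 0 < G.degree (Fin.castAdd G.m i) := by
  simp [degree]

/-- The share of group `k` in the total degree. -/
noncomputable def share (G : Graph K n₀) (k : Fin K) : ℝ :=
  (G.groupDegree k : ℝ) / (2 * (G.edges.length : ℝ) + (n₀ : ℝ))

lemma share_nonneg (G : Graph K n₀) (k : Fin K) : 0 ≤ G.share k := by
  unfold share; positivity

variable [NeZero n₀]

lemma total_pos (G : Graph K n₀) : 0 < 2 * (G.edges.length : ℝ) + (n₀ : ℝ) := by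
  have : 0 < (n₀ : ℝ) := by exact_mod_cast NeZero.pos n₀
  positivity

lemma sum_share (G : Graph K n₀) : ∑ k, G.share k = 1 := by
  have h : ∑ k, (G.groupDegree k : ℝ) = n₀ + 2 * G.edges.length := by
    exact_mod_cast G.sum_groupDegree
  simp only [share, ← Finset.sum_div, h]
  rw [add_comm]
  exact div_self G.total_pos.ne'

lemma share_le_one (G : Graph K n₀) (k : Fin K) : G.share k ≤ 1 := by
  rw [← G.sum_share]
  exact Finset.single_le_sum (fun l _ => G.share_nonneg l) (Finset.mem_univ k)

lemma share_pos (G : Graph K n₀) {i : Fin (n₀ + G.m)} (hi : 0 < G.degree i) :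
    0 < G.share (G.group i) := by
  refine div_pos ?_ G.total_pos
  have : G.degree i ≤ G.groupDegree (G.group i) := by
    have := Finset.single_le_sum
      (f := fun j => if G.group j = G.group i then G.degree j else 0)
      (fun _ _ => Nat.zero_le _) (Finset.mem_univ i)
    simpa [groupDegree] using this
  exact_mod_cast hi.trans_le this

lemma share_add_share_le_one (G : Graph K n₀) {k l : Fin K} (h : l ≠ k) :
    G.share k + G.share l ≤ 1 := by
  rw [← G.sum_share, ← Finset.sum_pair h.symm]
  exact Finset.sum_le_sum_of_subset_of_nonneg (Finset.subset_univ _)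
    fun l _ _ => G.share_nonneg l

lemma mem_support_pick (G : Graph K n₀) (i : Fin (n₀ + G.m)) :
    i ∈ G.pick.support ↔ 0 < G.degree i := by
  rw [pick, PMF.mem_support_normalize_iff]
  simp [Nat.pos_iff_ne_zero]

lemma pick_toReal (G : Graph K n₀) (i : Fin (n₀ + G.m)) :
    (G.pick i).toReal = (G.degree i : ℝ) / (2 * (G.edges.length : ℝ) + (n₀ : ℝ)) := by
  rw [pick, PMF.normalize_apply, tsum_fintype, ← Nat.cast_sum, G.sum_degree, ENNReal.toReal_mul,
    ENNReal.toReal_inv, ENNReal.toReal_natCast, ENNReal.toReal_natCast]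
  push_cast
  rw [add_comm (n₀ : ℝ)]
  rfl

/-- A node chosen by preferential attachment belongs to group `k` with probability
`G.share k`. -/
lemma expect_pick_group (G : Graph K n₀) {φ : Fin K → ℝ} (hφ : ∀ k, 0 ≤ φ k) :
    (G.pick.expect fun i => ENNReal.ofReal (φ (G.group i)))
      = ENNReal.ofReal (∑ k, G.share k * φ k) := by
  rw [PMF.expect_ofReal _ fun i => hφ _]
  congr 1
  simp only [pick_toReal, share, groupDegree]
  push_cast
  simp only [Finset.sum_div, Finset.sum_mul]
  rw [Finset.sum_comm]
  refine Finset.sum_congr rfl fun i _ => ?_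
  rw [Finset.sum_eq_single (G.group i)]
  · simp
  · intro k _ hk
    simp [hk.symm]
  · simp

lemma expect_pick_two (G : Graph K n₀) (k : Fin K) {a b : ℝ} (ha : 0 ≤ a) (hb : 0 ≤ b) :
    (G.pick.expect fun i => ENNReal.ofReal (if G.group i = k then a else b))
      = ENNReal.ofReal (G.share k * a + (1 - G.share k) * b) := by
  rw [G.expect_pick_group (φ := fun l => if l = k then a else b)
    (fun l => by split_ifs <;> assumption)]
  congr 1
  have : ∀ l, G.share l * (if l = k then a else b)
      = G.share l * b + if l = k then G.share l * (a - b) else 0 := fun l => by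
    split_ifs <;> ring
  simp only [this, Finset.sum_add_distrib, ← Finset.sum_mul, G.sum_share]
  simp
  ring

end Graph

/-! ### The probability of a connection between different groups. -/

namespace Homophily

lemma denom_pos (h : Homophily) : 0 < h.γ + h.α * (1 - h.γ) :=
  add_pos_of_pos_of_nonneg h.γ_pos (mul_nonneg h.α_pos.le (sub_nonneg.2 h.γ_le_one))

lemma theta_pos (h : Homophily) : 0 < h.theta := div_pos h.γ_pos h.denom_pos

lemma theta_le_one (h : Homophily) : h.theta ≤ 1 :=
  (div_le_one h.denom_pos).2 <|
    le_add_of_nonneg_right (mul_nonneg h.α_pos.le (sub_nonneg.2 h.γ_le_one))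

end Homophily

variable [NeZero n₀]

lemma expect_proposal (h : Homophily) (G : Graph K n₀) (k : Fin K)
    (hs : ∃ i ∈ {i | G.group i = k}, i ∈ G.pick.support)
    (ho : ∃ i ∈ {i | G.group i ≠ k}, i ∈ G.pick.support)
    {f : Option (Fin (n₀ + G.m)) → ℝ≥0∞} {a b c : ℝ} (ha : 0 ≤ a) (hb : 0 ≤ b) (hc : 0 ≤ c)
    (hfs : ∀ i, G.group i = k → f (some i) = ENNReal.ofReal a)
    (hfo : ∀ i, G.group i ≠ k → f (some i) = ENNReal.ofReal b)
    (hfn : f none = ENNReal.ofReal c) :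
    (proposal h G k hs ho).expect f
      = ENNReal.ofReal (h.α * a + (1 - h.α) * (h.γ * b + (1 - h.γ) * c)) := by
  have hα := h.α_pos.le
  have hα' := sub_nonneg.2 h.α_le_one
  have hγ := h.γ_pos.le
  have hγ' := sub_nonneg.2 h.γ_le_one
  rw [proposal, PMF.expect_bind, expect_coin]
  simp only [if_true, Bool.false_eq_true, if_false, PMF.expect_map, PMF.expect_bind, expect_coin]
  rw [expect_filter_of_const _ {i | G.group i = k} hs (c := ENNReal.ofReal a)
      (fun i hi => hfs i hi),
    expect_filter_of_const _ {i | G.group i ≠ k} ho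
      (c := ENNReal.ofReal (h.γ * b + (1 - h.γ) * c))]
  · rw [← ENNReal.ofReal_mul hα, ← ENNReal.ofReal_mul hα', ← ENNReal.ofReal_add] <;> positivity
  · intro i hi
    rw [hfo i hi, hfn, ← ENNReal.ofReal_mul hγ, ← ENNReal.ofReal_mul hγ', ← ENNReal.ofReal_add]
      <;> positivity

/-- A trial is rejected with probability `(1 - α)(1 - γ)`, so the acceptance probability is `γ + α
(1 - γ)`, the denominator of `θ`. -/
lemma expect_untilAccepted_proposal (h : Homophily) (G : Graph K n₀) (k : Fin K)
    (hs : ∃ i ∈ {i | G.group i = k}, i ∈ G.pick.support)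
    (ho : ∃ i ∈ {i | G.group i ≠ k}, i ∈ G.pick.support)
    {a b : ℝ} (ha : 0 ≤ a) (hb : 0 ≤ b) :
    ((untilAccepted (proposal h G k hs ho) (proposal_none_ne_one h G k hs ho)).expect
        fun u => ENNReal.ofReal (if G.group u = k then a else b))
      = ENNReal.ofReal
        ((h.α * a + (1 - h.α) * h.γ * b) / (h.γ + h.α * (1 - h.γ))) := by
  have hα' := sub_nonneg.2 h.α_le_one
  have hγ := h.γ_pos.le
  have hγ' := sub_nonneg.2 h.γ_le_one
  have hn : proposal h G k hs ho none = ENNReal.ofReal ((1 - h.α) * (1 - h.γ)) := by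
    -- The rejection probability is the expectation of the indicator of `none`.
    have e := expect_proposal h G k hs ho (f := fun o => if o = none then 1 else 0)
      (a := 0) (b := 0) (c := 1) le_rfl le_rfl zero_le_one (by simp) (by simp) (by simp)
    rw [PMF.expect, tsum_eq_single none (by intro o ho; simp [ho])] at e
    simpa using e
  have h1 : (1 : ℝ≥0∞) - proposal h G k hs ho none
      = ENNReal.ofReal (h.γ + h.α * (1 - h.γ)) := by
    rw [hn, ← ENNReal.ofReal_one, ← ENNReal.ofReal_sub _ (mul_nonneg hα' hγ')]
    congr 1
    ring
  rw [expect_untilAccepted, h1,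
    expect_proposal h G k hs ho (a := a) (b := b) (c := 0) ha hb le_rfl
      (fun i hi => by simp [hi]) (fun i hi => by simp [hi]) (by simp),
    ← ENNReal.ofReal_inv_of_pos h.denom_pos, ← ENNReal.ofReal_mul (inv_nonneg.2 h.denom_pos.le)]
  congr 1
  rw [div_eq_inv_mul]
  ring

/-- The probability that a node of group `k` gets connected to a node of another group is
`(1 - P) θ`, where `P` is the share of group `k` in the total degree. -/
lemma expect_target (h : Homophily) (G : Graph K n₀) (k : Fin K)
    (hs : ∃ i, G.group i = k ∧ 0 < G.degree i) (ho : ∃ i, G.group i ≠ k ∧ 0 < G.degree i)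
    {a b : ℝ} (ha : 0 ≤ a) (hb : 0 ≤ b) :
    ((target h G k).expect fun u => ENNReal.ofReal (if G.group u = k then a else b))
      = ENNReal.ofReal ((1 - h.theta * (1 - G.share k)) * a
        + h.theta * (1 - G.share k) * b) := by
  have hα := h.α_pos.le
  have hα' := sub_nonneg.2 h.α_le_one
  have hγ := h.γ_pos.le
  have hγ' := sub_nonneg.2 h.γ_le_one
  have hD := h.denom_pos
  have hh : (∃ i ∈ {i | G.group i = k}, i ∈ G.pick.support) ∧
      (∃ i ∈ {i | G.group i ≠ k}, i ∈ G.pick.support) := by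
    simp only [G.mem_support_pick]
    exact ⟨hs, ho⟩
  have hV : 0 ≤ (h.α * a + (1 - h.α) * h.γ * b) / (h.γ + h.α * (1 - h.γ)) := by positivity
  rw [target, PMF.expect_bind]
  have key := G.expect_pick_two k (a := a) (b := h.γ * b + (1 - h.γ) *
    ((h.α * a + (1 - h.α) * h.γ * b) / (h.γ + h.α * (1 - h.γ)))) ha (by positivity)
  refine (PMF.expect_congr _ fun u₁ _ => ?_).trans (key.trans ?_)
  · by_cases hu : G.group u₁ = k
    · simp only [hu, if_true, PMF.expect_pure]
    · simp only [if_neg hu, PMF.expect_bind, expect_coin, if_true, Bool.false_eq_true, if_false,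
        dif_pos hh, PMF.expect_pure]
      rw [expect_untilAccepted_proposal h G k hh.1 hh.2 ha hb, ← ENNReal.ofReal_mul hγ,
        ← ENNReal.ofReal_mul hγ', ← ENNReal.ofReal_add (by positivity) (by positivity)]
  · have hD' := mul_inv_cancel₀ hD.ne'
    congr 1
    rw [Homophily.theta, div_eq_mul_inv, div_eq_mul_inv]
    -- With `D = γ + α (1 - γ) = 1 - (1 - α)(1 - γ)`, the two sides differ by this multiple of `D *
    -- D⁻¹ - 1`.
    linear_combination (1 - G.share k) * (a - h.γ * b) * hD'

end KPA

namespace KPA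

/-! ### Elementary inequalities -/

lemma exp_half_log_sub {x y : ℝ} (hx : 0 < x) (hy : 0 < y) :
    Real.exp (1 / 2 * (Real.log x - Real.log y)) = √(x / y) := by
  rw [← Real.log_div hx.ne' hy.ne', Real.sqrt_eq_rpow, Real.rpow_def_of_pos (div_pos hx hy),
    mul_comm]

/-- Turns a mean of square-root likelihood ratios into a Hellinger affinity. The case `x = 0` is
needed, since a true probability may vanish. -/
lemma mul_sqrt_div {x y : ℝ} (hx : 0 ≤ x) : x * √(y / x) = √x * √y := by
  rw [Real.sqrt_div' _ hx]
  rcases hx.eq_or_lt with rfl | hx'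
  · simp
  · have h : √x ≠ 0 := (Real.sqrt_pos.2 hx').ne'
    nth_rewrite 1 [← Real.mul_self_sqrt hx]
    field_simp

/-- A bound for the Hellinger affinity of the laws on two points that give the masses `a * Q` and
`lo * Q` to the first point, where `lo` is replaced by a larger `hi` on the first point. -/
lemma affinity_le {a lo hi Q : ℝ} (ha0 : 0 ≤ a) (ha1 : a ≤ 1) (hlo0 : 0 ≤ lo) (hlo1 : lo ≤ 1)
    (hlohi : lo ≤ hi) (hQ0 : 0 ≤ Q) (hQ1 : Q ≤ 1) :
    (1 - a * Q) * √((1 - lo * Q) / (1 - a * Q)) + a * Q * √(hi / a)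
      ≤ 1 + √(hi - lo) - Q * ((√a - √lo) ^ 2 / 2) := by
  have hx : 0 ≤ 1 - a * Q := sub_nonneg.2 (mul_le_one₀ ha1 hQ0 hQ1)
  have hy : 0 ≤ 1 - lo * Q := sub_nonneg.2 (mul_le_one₀ hlo1 hQ0 hQ1)
  have h1 : √hi ≤ √lo + √(hi - lo) := by
    rw [Real.sqrt_le_left (by positivity), add_sq, Real.sq_sqrt hlo0,
      Real.sq_sqrt (sub_nonneg.2 hlohi)]
    have : 0 ≤ 2 * √lo * √(hi - lo) := by positivity
    linarith
  have h2 : √a * √hi ≤ √a * √lo + √(hi - lo) := by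
    have := mul_le_mul_of_nonneg_left h1 (Real.sqrt_nonneg a)
    have := mul_le_mul_of_nonneg_right (Real.sqrt_le_one.2 ha1) (Real.sqrt_nonneg (hi - lo))
    linarith
  have h3 : Q * (√a * √hi) ≤ Q * (√a * √lo) + √(hi - lo) := by
    have := mul_le_mul_of_nonneg_left h2 hQ0
    have := mul_le_mul_of_nonneg_right hQ1 (Real.sqrt_nonneg (hi - lo))
    linarith
  -- AM–GM discards the contribution of this point to the Hellinger distance; the other point alone
  -- provides the square in the bound.
  have h4 : √(1 - a * Q) * √(1 - lo * Q) ≤ ((1 - a * Q) + (1 - lo * Q)) / 2 := by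
    have := sq_nonneg (√(1 - a * Q) - √(1 - lo * Q))
    have := Real.sq_sqrt hx
    have := Real.sq_sqrt hy
    linarith
  have h5 : a * Q * √(hi / a) = Q * (√a * √hi) := by
    rw [← mul_sqrt_div ha0]; ring
  have h6 : Q * ((√a - √lo) ^ 2 / 2) = Q * ((a + lo) / 2 - √a * √lo) := by
    rw [sub_sq, Real.sq_sqrt ha0, Real.sq_sqrt hlo0]; ring
  rw [mul_sqrt_div hx, h5, h6]
  linarith

variable {K n₀ : ℕ}

/-! ### Reachable networks -/

/-- `G` has `t` edges, and its initial nodes have the groups `g₀`. -/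
structure Graph.IsGrown (g₀ : Fin n₀ → Fin K) (t : ℕ) (G : Graph K n₀) : Prop where
  length : G.edges.length = t
  group : ∀ i : Fin n₀, G.group (Fin.castAdd G.m i) = g₀ i

namespace Graph

lemma isGrown_initial (g₀ : Fin n₀ → Fin K) : (initial g₀).IsGrown g₀ 0 :=
  ⟨rfl, fun _ => rfl⟩

lemma IsGrown.addVertex {g₀ : Fin n₀ → Fin K} {t : ℕ} {G : Graph K n₀} (hG : G.IsGrown g₀ t)
    (k : Fin K) (u : Fin (n₀ + G.m)) : (G.addVertex k u).IsGrown g₀ (t + 1) := by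
  refine ⟨by simp [Graph.addVertex, hG.length], fun i => ?_⟩
  rw [← hG.group i]
  exact Fin.snoc_castSucc (α := fun _ => Fin K) k G.group (Fin.castAdd G.m i)

lemma IsGrown.addEdge {g₀ : Fin n₀ → Fin K} {t : ℕ} {G : Graph K n₀} (hG : G.IsGrown g₀ t)
    (w u : Fin (n₀ + G.m)) : (G.addEdge w u).IsGrown g₀ (t + 1) :=
  ⟨by simp [Graph.addEdge, hG.length], hG.group⟩

lemma lastGroups_addVertex (G : Graph K n₀) (k : Fin K) (u : Fin (n₀ + G.m)) :
    (G.addVertex k u).lastGroups = some (k, G.group u) := by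
  have h1 : (G.addVertex k u).group (Fin.last (n₀ + G.m)) = k :=
    Fin.snoc_last (α := fun _ => Fin K) k G.group
  have h2 : (G.addVertex k u).group u.castSucc = G.group u :=
    Fin.snoc_castSucc (α := fun _ => Fin K) k G.group u
  change some ((G.addVertex k u).group (Fin.last (n₀ + G.m)),
    (G.addVertex k u).group u.castSucc) = _
  rw [h1, h2]

lemma lastGroups_addEdge (G : Graph K n₀) (w u : Fin (n₀ + G.m)) :
    (G.addEdge w u).lastGroups = some (G.group w, G.group u) := rfl

lemma IsGrown.exists_group_eq {g₀ : Fin n₀ → Fin K} {t : ℕ} {G : Graph K n₀}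
    (hG : G.IsGrown g₀ t) {k : Fin K} (h : ∃ i, g₀ i = k) :
    ∃ i, G.group i = k ∧ 0 < G.degree i := by
  obtain ⟨i, hi⟩ := h
  exact ⟨Fin.castAdd G.m i, (hG.group i).trans hi, G.degree_castAdd_pos i⟩

lemma IsGrown.exists_group_ne {g₀ : Fin n₀ → Fin K} {t : ℕ} {G : Graph K n₀}
    (hG : G.IsGrown g₀ t) {k : Fin K} (h : ∃ i, g₀ i ≠ k) :
    ∃ i, G.group i ≠ k ∧ 0 < G.degree i := by
  obtain ⟨i, hi⟩ := h
  exact ⟨Fin.castAdd G.m i, (hG.group i).trans_ne hi, G.degree_castAdd_pos i⟩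

end Graph

/-! ### The likelihood of one step -/

/-- Only the summand of the group of `w` survives, and `P + (1 - θ)(1 - P) = 1 - θ (1 - P)`. The
product form isolates the factor free of `θ`. -/
lemma stepLogLik_of_vertex {G G' : Graph K n₀} {t : ℕ} (ht : G.edges.length = t)
    (hm : G'.m = G.m + 1) {k l : Fin K} (hl : G'.lastGroups = some (k, l)) (θ : ℝ) :
    stepLogLik θ t G G' = Real.log ((if l = k then 1 else 1 - G.share k) *
      (if l = k then 1 - θ * (1 - G.share k) else θ)) := by
  subst ht
  unfold stepLogLik
  simp only [hm, hl, true_and, not_true_eq_false, false_and, if_false, Finset.sum_const_zero,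
    add_zero, Option.some.injEq, Prod.mk.injEq]
  rw [Finset.sum_eq_single k, Finset.sum_eq_single k]
  · by_cases h : l = k
    · subst h
      simp only [and_self, if_true, Graph.share]
      rw [if_neg (by rintro ⟨l', h1, -, h2⟩; exact h1 h2.symm), add_zero]
      congr 1
      ring
    · simp only [h, if_false, and_false]
      rw [if_pos ⟨l, h, trivial, rfl⟩, zero_add]
      rfl
  · rintro k' - hk'
    exact if_neg (by rintro ⟨_, -, h, -⟩; exact hk' h.symm)
  · simp
  · rintro k' - hk'
    exact if_neg fun h => hk' h.1.symm
  · simp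

lemma stepLogLik_of_edge {G G' : Graph K n₀} {t : ℕ} (ht : G.edges.length = t)
    (hm : G'.m = G.m) {k l : Fin K} (hl : G'.lastGroups = some (k, l)) (θ : ℝ) :
    stepLogLik θ t G G'
      = Real.log ((if l = k then G.share k else G.share k * (1 - G.share k)) *
        (if l = k then 1 - θ * (1 - G.share k) else θ)) := by
  subst ht
  unfold stepLogLik
  simp only [hm, hl, left_eq_add, one_ne_zero, not_false_eq_true, true_and, false_and, if_false,
    Finset.sum_const_zero, zero_add, Option.some.injEq, Prod.mk.injEq]
  rw [Finset.sum_eq_single k, Finset.sum_eq_single k]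
  · by_cases h : l = k
    · subst h
      simp only [and_self, if_true, Graph.share]
      rw [if_neg (by rintro ⟨l', h1, -, h2⟩; exact h1 h2.symm), add_zero]
      congr 1
      ring
    · simp only [h, if_false, and_false]
      rw [if_pos ⟨l, h, trivial, rfl⟩, zero_add]
      rfl
  · rintro k' - hk'
    exact if_neg (by rintro ⟨_, -, h, -⟩; exact hk' h.symm)
  · simp
  · rintro k' - hk'
    exact if_neg fun h => hk' h.1.symm
  · simp

/-- An upper bound for the square root of the likelihood ratio of one step at any parameter in
`[lo, hi]` against `θ`. -/
noncomputable def weight (lo hi θ : ℝ) (G G' : Graph K n₀) : ℝ :=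
  match G'.lastGroups with
  | none => 0
  | some (k, l) => if l = k then √((1 - lo * (1 - G.share k)) / (1 - θ * (1 - G.share k)))
      else √(hi / θ)

lemma weight_of_lastGroups {G G' : Graph K n₀} {k l : Fin K} (hl : G'.lastGroups = some (k, l))
    (lo hi θ : ℝ) : weight lo hi θ G G'
      = if l = k then √((1 - lo * (1 - G.share k)) / (1 - θ * (1 - G.share k)))
        else √(hi / θ) := by
  rw [weight, hl]

lemma weight_nonneg (lo hi θ : ℝ) (G G' : Graph K n₀) : 0 ≤ weight lo hi θ G G' := by
  unfold weight
  split
  · exact le_rfl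
  · split_ifs <;> exact Real.sqrt_nonneg _

/-- What is used of a step of positive probability: the likelihood is, up to a factor in `(0, 1]`
that does not involve the parameter, a Bernoulli likelihood. -/
structure IsTransition (g₀ : Fin n₀ → Fin K) (t : ℕ) (G G' : Graph K n₀) : Prop where
  grown : G'.IsGrown g₀ (t + 1)
  logLik : ∃ k l, G'.lastGroups = some (k, l) ∧ 0 < G.share k ∧ G.share k < 1 ∧
    ∃ c, 0 < c ∧ c ≤ 1 ∧ ∀ θ,
      stepLogLik θ t G G' = Real.log (c * (if l = k then 1 - θ * (1 - G.share k) else θ))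

namespace IsTransition

variable {g₀ : Fin n₀ → Fin K} {t : ℕ} {G G' : Graph K n₀}

/-- Bounds the log-likelihood above, so that the real suprema in `profileLogLik` are genuine ones
and not default values. -/
lemma stepLogLik_nonpos (h : IsTransition g₀ t G G') {θ : ℝ} (h0 : 0 < θ) (h1 : θ ≤ 1) :
    stepLogLik θ t G G' ≤ 0 := by
  obtain ⟨k, l, -, hP0, hP1, c, hc0, hc1, hc⟩ := h.logLik
  rw [hc]
  have hx : 0 ≤ 1 - θ * (1 - G.share k) := by nlinarith
  split_ifs
  · exact Real.log_nonpos (mul_nonneg hc0.le hx) (mul_le_one₀ hc1 hx (by nlinarith))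
  · exact Real.log_nonpos (by positivity) (mul_le_one₀ hc1 h0.le h1)

/-- The likelihood of a connection inside the group decreases in the parameter and that of one
outside increases, whence `lo` in one case of `weight` and `hi` in the other. -/
lemma exp_le_weight (h : IsTransition g₀ t G G') {lo hi θ θ' : ℝ} (h0 : 0 < θ) (h1 : θ ≤ 1)
    (h0' : 0 < θ') (h1' : θ' ≤ 1) (hlo : lo ≤ θ') (hhi : θ' ≤ hi) :
    Real.exp (1 / 2 * (stepLogLik θ' t G G' - stepLogLik θ t G G')) ≤ weight lo hi θ G G' := by
  obtain ⟨k, l, hl, hP0, hP1, c, hc0, -, hc⟩ := h.logLik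
  have pos : ∀ x : ℝ, 0 < x → x ≤ 1 → 0 < 1 - x * (1 - G.share k) := fun x _ _ => by nlinarith
  rw [hc, hc, weight_of_lastGroups hl]
  have hx := pos θ h0 h1
  have hx' := pos θ' h0' h1'
  split_ifs
  · rw [exp_half_log_sub (by positivity) (by positivity), mul_div_mul_left _ _ hc0.ne']
    exact Real.sqrt_le_sqrt (by gcongr)
  · rw [exp_half_log_sub (by positivity) (by positivity), mul_div_mul_left _ _ hc0.ne']
    exact Real.sqrt_le_sqrt (by gcongr)

end IsTransition

variable [NeZero n₀]

/-! ### One step of the process -/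

section Step

variable {p : PMF (Fin K)} {g₀ : Fin n₀ → Fin K} {q : ℝ} {hq0 : 0 ≤ q} {hq1 : q ≤ 1}
  {t : ℕ} {G G' : Graph K n₀}

/-- Initial nodes keep positive degree. So the share of `w`'s group is below 1, as some initial node
lies outside it. It is positive because an arriving group has an initial node, and in an edge-step
because `w` itself has positive degree. -/
lemma isTransition_of_mem_support (h : Homophily) (hp0 : ∀ k ∈ p.support, ∃ i, g₀ i = k)
    (hp1 : ∀ k, ∃ i, g₀ i ≠ k) (hG : G.IsGrown g₀ t)
    (hG' : G' ∈ (step p q hq0 hq1 h G).support) : IsTransition g₀ t G G' := by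
  have lt_one : ∀ k, G.share k < 1 := fun k => by
    obtain ⟨i, hi, hi'⟩ := hG.exists_group_ne (hp1 k)
    have := G.share_pos hi'
    have := G.share_add_share_le_one hi
    linarith
  rw [step, PMF.mem_support_bind_iff] at hG'
  obtain ⟨v, -, hv⟩ := hG'
  cases v with
  | true =>
    rw [if_pos rfl, PMF.mem_support_bind_iff] at hv
    obtain ⟨k, hk, hv⟩ := hv
    obtain ⟨u, -, rfl⟩ := (PMF.mem_support_map_iff _ _ _).1 hv
    obtain ⟨i, rfl, hi⟩ := hG.exists_group_eq (hp0 k hk)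
    have h1 := lt_one (G.group i)
    have h0 := G.share_pos hi
    refine ⟨hG.addVertex _ u, G.group i, G.group u, G.lastGroups_addVertex _ u, h0, h1, _, ?_, ?_,
      stepLogLik_of_vertex (G' := G.addVertex _ u) hG.length rfl (G.lastGroups_addVertex _ u)⟩
    · split_ifs <;> linarith
    · split_ifs <;> linarith
  | false =>
    rw [if_neg Bool.false_ne_true, PMF.mem_support_bind_iff] at hv
    obtain ⟨w, hw, hv⟩ := hv
    obtain ⟨u, -, rfl⟩ := (PMF.mem_support_map_iff _ _ _).1 hv
    have h1 := lt_one (G.group w)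
    have h0 := G.share_pos ((G.mem_support_pick w).1 hw)
    refine ⟨hG.addEdge w u, G.group w, G.group u, G.lastGroups_addEdge w u, h0, h1, _, ?_, ?_,
      stepLogLik_of_edge (G' := G.addEdge w u) hG.length rfl (G.lastGroups_addEdge w u)⟩
    · split_ifs
      · exact h0
      · exact mul_pos h0 (sub_pos.2 h1)
    · split_ifs
      · exact h1.le
      · exact mul_le_one₀ h1.le (sub_nonneg.2 h1.le) (by linarith)

/-- `F` stands for either kind of step: `weight` sees the new network only through the groups of the
new edge. -/
lemma expect_target_weight_le (h : Homophily) {k : Fin K}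
    (hs : ∃ i, G.group i = k ∧ 0 < G.degree i) (ho : ∃ i, G.group i ≠ k ∧ 0 < G.degree i)
    {lo hi : ℝ} (hlo0 : 0 ≤ lo) (hlo1 : lo ≤ 1) (hlohi : lo ≤ hi)
    (F : Fin (n₀ + G.m) → Graph K n₀) (hF : ∀ u, (F u).lastGroups = some (k, G.group u)) :
    ((target h G k).expect fun u => ENNReal.ofReal (weight lo hi h.theta G (F u)))
      ≤ ENNReal.ofReal (1 + √(hi - lo) - (1 - G.share k) * ((√h.theta - √lo) ^ 2 / 2)) := by
  have e : ∀ u, weight lo hi h.theta G (F u) = _ := fun u => weight_of_lastGroups (hF u) _ _ _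
  simp only [e]
  rw [expect_target h G k hs ho (Real.sqrt_nonneg _) (Real.sqrt_nonneg _)]
  exact ENNReal.ofReal_le_ofReal (affinity_le h.theta_pos.le h.theta_le_one hlo0 hlo1 hlohi
    (sub_nonneg.2 (G.share_le_one k)) (sub_le_self _ (G.share_nonneg k)))

/-- The conditional expectation of `weight` given the past. -/
lemma expect_step_weight_le (h : Homophily) (hp0 : ∀ k ∈ p.support, ∃ i, g₀ i = k)
    (hp1 : ∀ k, ∃ i, g₀ i ≠ k) {r : ℝ} (hr : ∀ k, (p k).toReal ≤ r) (hG : G.IsGrown g₀ t)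
    {lo hi : ℝ} (hlo0 : 0 ≤ lo) (hlo1 : lo ≤ 1) (hlohi : lo ≤ hi) :
    ((step p q hq0 hq1 h G).expect fun G' => ENNReal.ofReal (weight lo hi h.theta G G'))
      ≤ ENNReal.ofReal
        (Real.exp (√(hi - lo) - q * (1 - r) * ((√h.theta - √lo) ^ 2 / 2))) := by
  set D := (√h.theta - √lo) ^ 2 / 2 with hD
  have hD0 : 0 ≤ D := by positivity
  have hD1 : D ≤ 1 := by
    have h1 := Real.sqrt_nonneg h.theta
    have h2 := Real.sqrt_nonneg lo
    have h3 := Real.sqrt_le_one.2 h.theta_le_one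
    have h4 := Real.sqrt_le_one.2 hlo1
    rw [hD]
    nlinarith
  set g := √(hi - lo) with hg
  have hg0 : 0 ≤ g := Real.sqrt_nonneg _
  have bound_nonneg : ∀ k, 0 ≤ 1 + g - (1 - G.share k) * D := fun k => by
    have := mul_le_one₀ (sub_le_self _ (G.share_nonneg k)) hD0 hD1
    linarith
  rw [step, PMF.expect_bind, expect_coin]
  simp only [if_true, Bool.false_eq_true, if_false, PMF.expect_bind, PMF.expect_map]
  have hV : (p.expect fun k => (target h G k).expect fun u =>
      ENNReal.ofReal (weight lo hi h.theta G (G.addVertex k u)))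
      ≤ ENNReal.ofReal (1 + g - (1 - r) * D) := by
    refine (p.expect_mono fun k hk => expect_target_weight_le h
      (hG.exists_group_eq (hp0 k hk)) (hG.exists_group_ne (hp1 k)) hlo0 hlo1 hlohi
      _ (G.lastGroups_addVertex k)).trans ?_
    rw [PMF.expect_ofReal _ bound_nonneg]
    refine ENNReal.ofReal_le_ofReal ?_
    have e : ∑ k, (p k).toReal * (1 + g - (1 - G.share k) * D)
        = (1 + g - D) + (∑ k, (p k).toReal * G.share k) * D := by
      have : ∀ k, (p k).toReal * (1 + g - (1 - G.share k) * D)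
          = (p k).toReal * (1 + g - D) + (p k).toReal * G.share k * D := fun k => by ring
      simp only [this, Finset.sum_add_distrib, ← Finset.sum_mul, p.sum_toReal, one_mul]
    -- The source of uniformity: a convex combination of the `p k` is at most `r`, whatever the
    -- shares.
    have e2 : ∑ k, (p k).toReal * G.share k ≤ r := by
      calc ∑ k, (p k).toReal * G.share k ≤ ∑ k, r * G.share k :=
            Finset.sum_le_sum fun k _ => mul_le_mul_of_nonneg_right (hr k) (G.share_nonneg k)
        _ = r := by rw [← Finset.mul_sum, G.sum_share, mul_one]
    rw [e]
    nlinarith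
  -- The gain from edge-steps is dropped: it has no uniform lower bound, as one group may hold
  -- almost all the degree.
  have hE : (G.pick.expect fun w => (target h G (G.group w)).expect fun u =>
      ENNReal.ofReal (weight lo hi h.theta G (G.addEdge w u))) ≤ ENNReal.ofReal (1 + g) := by
    refine (G.pick.expect_mono (g := fun _ => ENNReal.ofReal (1 + g)) fun w hw => ?_).trans
      (PMF.expect_const _ _).le
    refine (expect_target_weight_le h ⟨w, rfl, (G.mem_support_pick w).1 hw⟩
      (hG.exists_group_ne (hp1 _)) hlo0 hlo1 hlohi _ (G.lastGroups_addEdge w)).trans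
      (ENNReal.ofReal_le_ofReal ?_)
    exact sub_le_self _ (mul_nonneg (sub_nonneg.2 (G.share_le_one _)) hD0)
  have hr0 : 0 ≤ 1 + g - (1 - r) * D := by
    have : 0 ≤ r := ENNReal.toReal_nonneg.trans (hr (G.group 0))
    nlinarith
  have hq1' := sub_nonneg.2 hq1
  calc _ ≤ ENNReal.ofReal q * ENNReal.ofReal (1 + g - (1 - r) * D)
        + ENNReal.ofReal (1 - q) * ENNReal.ofReal (1 + g) := by gcongr
    _ = ENNReal.ofReal (1 + (g - q * (1 - r) * D)) := by
        rw [← ENNReal.ofReal_mul hq0, ← ENNReal.ofReal_mul hq1',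
          ← ENNReal.ofReal_add (by positivity) (by positivity)]
        congr 1
        ring
    _ ≤ _ := by
        refine ENNReal.ofReal_le_ofReal ?_
        rw [add_comm]
        exact Real.add_one_le_exp _

end Step

end KPA

namespace KPA

/-! ### Deterministic facts about sums and grids -/

/-- The index is `⌈x * N⌉₊ - 1` rather than a floor, so that `x = 1` falls into the last cell. -/
lemma exists_grid_cell {N : ℕ} (hN : 0 < N) {x : ℝ} (h0 : 0 < x) (h1 : x ≤ 1) :
    ∃ j ∈ Finset.range N, (j : ℝ) / N ≤ x ∧ x ≤ ((j : ℝ) + 1) / N := by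
  have hN' : (0 : ℝ) < N := by exact_mod_cast hN
  have hc : 0 < ⌈x * N⌉₊ := Nat.ceil_pos.2 (by positivity)
  obtain ⟨j, hj⟩ := Nat.exists_eq_succ_of_ne_zero hc.ne'
  have hle : ⌈x * N⌉₊ ≤ N := Nat.ceil_le.2 (by nlinarith)
  refine ⟨j, Finset.mem_range.2 (by omega), ?_, ?_⟩
  · rw [div_le_iff₀ hN']
    exact (Nat.lt_ceil.1 (by omega)).le
  · rw [le_div_iff₀ hN']
    have := Nat.le_ceil (x * N)
    rw [hj] at this
    exact_mod_cast this

/-- Two step functions with different jump times, the first of which jumps from `x₁` to `x₂`, are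
far from each other in `ℓ²`. -/
lemma le_sum_sq_sub_of_jumps {σ τ T : ℕ} (hσ : σ ≤ T) (hτ : τ ≤ T) {L : ℝ} (hL : 0 ≤ L)
    (hL1 : L ≤ τ) (hL2 : L ≤ (T : ℝ) - τ) (hL3 : L ≤ |(σ : ℝ) - τ|) (x₁ x₂ y₁ y₂ : ℝ) :
    L * ((x₁ - x₂) ^ 2 / 2) ≤ ∑ t ∈ Finset.range T,
      ((if t < τ then x₁ else x₂) - (if t < σ then y₁ else y₂)) ^ 2 := by
  set d : ℕ → ℝ := fun t =>
    ((if t < τ then x₁ else x₂) - (if t < σ then y₁ else y₂)) ^ 2 with hd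
  have hd0 : ∀ t, 0 ≤ d t := fun t => sq_nonneg _
  have block : ∀ a b : ℕ, ∀ v : ℝ, a ≤ b → (∀ t, a ≤ t → t < b → d t = v) →
      ∑ t ∈ Finset.Ico a b, d t = ((b : ℝ) - a) * v := fun a b v hab h => by
    rw [Finset.sum_congr rfl fun t ht => h t (Finset.mem_Ico.1 ht).1 (Finset.mem_Ico.1 ht).2,
      Finset.sum_const, Nat.card_Ico, nsmul_eq_mul, Nat.cast_sub hab]
  -- On two adjacent blocks of length at least `L`, meeting at `τ`, the second function is a
  -- constant `y` while the first takes both its values; no `y` is close to both.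
  have par : ∀ y : ℝ, (x₁ - x₂) ^ 2 / 2 ≤ (x₁ - y) ^ 2 + (x₂ - y) ^ 2 := fun y => by
    nlinarith [sq_nonneg (x₁ + x₂ - 2 * y)]
  rcases le_total σ τ with h | h
  · have h1 := block σ τ ((x₁ - y₂) ^ 2) h fun t h1 h2 => by
      simp only [hd]; rw [if_pos h2, if_neg (by omega)]
    have h2 := block τ T ((x₂ - y₂) ^ 2) hτ fun t h1 h2 => by
      simp only [hd]; rw [if_neg (by omega), if_neg (by omega)]
    have h3 : ∑ t ∈ Finset.Ico σ T, d t ≤ ∑ t ∈ Finset.range T, d t :=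
      Finset.sum_le_sum_of_subset_of_nonneg (fun t ht => by simp at ht ⊢; omega)
        fun t _ _ => hd0 t
    rw [← Finset.sum_Ico_consecutive d h hτ, h1, h2] at h3
    have h4 : L ≤ (τ : ℝ) - σ := by
      have : (σ : ℝ) ≤ τ := by exact_mod_cast h
      rwa [abs_sub_comm, abs_of_nonneg (by linarith)] at hL3
    have := mul_le_mul_of_nonneg_left (par y₂) hL
    have := mul_le_mul_of_nonneg_right h4 (sq_nonneg (x₁ - y₂))
    have := mul_le_mul_of_nonneg_right hL2 (sq_nonneg (x₂ - y₂))
    linarith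
  · have h1 := block 0 τ ((x₁ - y₁) ^ 2) (Nat.zero_le _) fun t h1 h2 => by
      simp only [hd]; rw [if_pos h2, if_pos (by omega)]
    have h2 := block τ σ ((x₂ - y₁) ^ 2) h fun t h1 h2 => by
      simp only [hd]; rw [if_neg (by omega), if_pos h2]
    have h3 : ∑ t ∈ Finset.Ico 0 σ, d t ≤ ∑ t ∈ Finset.range T, d t :=
      Finset.sum_le_sum_of_subset_of_nonneg (fun t ht => by simp at ht ⊢; omega)
        fun t _ _ => hd0 t
    rw [← Finset.sum_Ico_consecutive d (Nat.zero_le τ) h, h1, h2] at h3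
    have h4 : L ≤ (σ : ℝ) - τ := by
      have : (τ : ℝ) ≤ σ := by exact_mod_cast h
      rwa [abs_of_nonneg (by linarith)] at hL3
    have := mul_le_mul_of_nonneg_left (par y₁) hL
    have := mul_le_mul_of_nonneg_right hL1 (sq_nonneg (x₁ - y₁))
    have := mul_le_mul_of_nonneg_right h4 (sq_nonneg (x₂ - y₁))
    simp only [Nat.cast_zero, sub_zero] at h3
    linarith

variable {K n₀ : ℕ}

lemma logLik_add_logLik {T : ℕ} (G : Fin (T + 1) → Graph K n₀) (τ : ℕ) (θ₁ θ₂ : ℝ) :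
    logLik θ₁ G 0 τ + logLik θ₂ G τ T
      = ∑ t : Fin T, stepLogLik (if (t : ℕ) < τ then θ₁ else θ₂) t (G t.castSucc) (G t.succ) := by
  rw [logLik, logLik, ← Finset.sum_add_distrib]
  refine Finset.sum_congr rfl fun t _ => ?_
  by_cases h : (t : ℕ) < τ
  · rw [if_pos ⟨Nat.zero_le _, h⟩, if_neg (by omega), if_pos h, add_zero]
  · rw [if_neg (by omega), if_pos ⟨by omega, t.2⟩, if_neg h, zero_add]

/-- The step from `G_t` to `G_{t+1}` happens at time `t + 1`, hence the strict inequality. -/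
lemma theta_changeAt (τ : ℕ) (h₁ h₂ : Homophily) (t : ℕ) :
    (changeAt τ h₁ h₂ (t + 1)).theta = if t < τ then h₁.theta else h₂.theta := by
  unfold changeAt
  split_ifs <;> first | rfl | omega

/-! ### Likelihood ratios along a path -/

section Path

variable {g₀ : Fin n₀ → Fin K} {T : ℕ} {G : Fin (T + 1) → Graph K n₀}

lemma logLik_nonpos (hG : ∀ t : Fin T, IsTransition g₀ t (G t.castSucc) (G t.succ))
    {θ : ℝ} (h0 : 0 < θ) (h1 : θ ≤ 1) (a b : ℕ) : logLik θ G a b ≤ 0 :=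
  Finset.sum_nonpos fun t _ => by
    split_ifs
    · exact (hG t).stepLogLik_nonpos h0 h1
    · exact le_rfl

lemma logLik_add_logLik_le_profileLogLik
    (hG : ∀ t : Fin T, IsTransition g₀ t (G t.castSucc) (G t.succ)) (τ : ℕ) {θ₁ θ₂ : ℝ}
    (h₁ : θ₁ ∈ Set.Ioc (0 : ℝ) 1) (h₂ : θ₂ ∈ Set.Ioc (0 : ℝ) 1) :
    logLik θ₁ G 0 τ + logLik θ₂ G τ T ≤ profileLogLik G τ := by
  have bdd : ∀ a b : ℕ, BddAbove (Set.range fun θ : Set.Ioc (0 : ℝ) 1 => logLik θ G a b) :=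
    fun a b => ⟨0, by rintro _ ⟨θ, rfl⟩; exact logLik_nonpos hG θ.2.1 θ.2.2 a b⟩
  exact add_le_add (le_ciSup (bdd 0 τ) ⟨θ₁, h₁⟩) (le_ciSup (bdd τ T) ⟨θ₂, h₂⟩)

/-- The suprema need not be attained on `(0, 1]`; each costs a slack of 1. -/
lemma exists_profileLogLik_le (G : Fin (T + 1) → Graph K n₀) (σ : ℕ) :
    ∃ θ₁ ∈ Set.Ioc (0 : ℝ) 1, ∃ θ₂ ∈ Set.Ioc (0 : ℝ) 1,
      profileLogLik G σ ≤ logLik θ₁ G 0 σ + logLik θ₂ G σ T + 2 := by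
  have : Nonempty (Set.Ioc (0 : ℝ) 1) := ⟨⟨1, by simp⟩⟩
  obtain ⟨θ₁, h₁⟩ := exists_lt_of_lt_ciSup
    (sub_one_lt (⨆ θ : Set.Ioc (0 : ℝ) 1, logLik θ G 0 σ))
  obtain ⟨θ₂, h₂⟩ := exists_lt_of_lt_ciSup
    (sub_one_lt (⨆ θ : Set.Ioc (0 : ℝ) 1, logLik θ G σ T))
  refine ⟨θ₁, θ₁.2, θ₂, θ₂.2, ?_⟩
  rw [profileLogLik]
  linarith

/-- The bound for the likelihood ratio of one step when the change point is `τ` and the parameters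
before and after `σ` lie in the `i`-th and the `j`-th cell of the grid of mesh `1 / N`. -/
noncomputable def cellWeight (N : ℕ) (h₁ h₂ : Homophily) (τ σ i j t : ℕ) (G G' : Graph K n₀) : ℝ :=
  weight (((if t < σ then i else j : ℕ) : ℝ) / N) ((((if t < σ then i else j : ℕ) : ℝ) + 1) / N)
    (changeAt τ h₁ h₂ (t + 1)).theta G G'

lemma exists_cell_one_le_prod (hG : ∀ t : Fin T, IsTransition g₀ t (G t.castSucc) (G t.succ))
    (h₁ h₂ : Homophily) {N : ℕ} (hN : 0 < N) {τ σ : ℕ}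
    (hle : profileLogLik G τ ≤ profileLogLik G σ) :
    -- The factor `exp 1` is the square root of `exp 2`, which pays for the slack 2 of
    -- `exists_profileLogLik_le`.
    ∃ i ∈ Finset.range N, ∃ j ∈ Finset.range N, 1 ≤ ENNReal.ofReal (Real.exp 1) *
      ∏ t : Fin T, ENNReal.ofReal (cellWeight N h₁ h₂ τ σ i j t (G t.castSucc) (G t.succ)) := by
  obtain ⟨θ₁, hθ₁, θ₂, hθ₂, hσ⟩ := exists_profileLogLik_le G σ
  have hτ := logLik_add_logLik_le_profileLogLik hG τ ⟨h₁.theta_pos, h₁.theta_le_one⟩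
    ⟨h₂.theta_pos, h₂.theta_le_one⟩
  have key := hτ.trans (hle.trans hσ)
  rw [logLik_add_logLik, logLik_add_logLik] at key
  obtain ⟨i, hi, hi1, hi2⟩ := exists_grid_cell hN hθ₁.1 hθ₁.2
  obtain ⟨j, hj, hj1, hj2⟩ := exists_grid_cell hN hθ₂.1 hθ₂.2
  refine ⟨i, hi, j, hj, ?_⟩
  have hw : ∀ t : Fin T, 0 ≤ cellWeight N h₁ h₂ τ σ i j t (G t.castSucc) (G t.succ) :=
    fun t => weight_nonneg _ _ _ _ _
  rw [← ENNReal.ofReal_prod_of_nonneg fun t _ => hw t,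
    ← ENNReal.ofReal_mul (Real.exp_pos 1).le, ← ENNReal.ofReal_one]
  refine ENNReal.ofReal_le_ofReal ?_
  have hprod : Real.exp (∑ t : Fin T, 1 / 2 *
      (stepLogLik (if (t : ℕ) < σ then θ₁ else θ₂) t (G t.castSucc) (G t.succ)
        - stepLogLik (if (t : ℕ) < τ then h₁.theta else h₂.theta) t (G t.castSucc) (G t.succ)))
      ≤ ∏ t : Fin T, cellWeight N h₁ h₂ τ σ i j t (G t.castSucc) (G t.succ) := by
    rw [Real.exp_sum]
    refine Finset.prod_le_prod (fun t _ => (Real.exp_pos _).le) fun t _ => ?_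
    rw [← theta_changeAt τ h₁ h₂]
    refine (hG t).exp_le_weight (Homophily.theta_pos _) (Homophily.theta_le_one _) ?_ ?_ ?_ ?_ <;>
      split_ifs <;> first | assumption | exact hθ₁.1 | exact hθ₂.1 | exact hθ₁.2 | exact hθ₂.2
  rw [← Finset.mul_sum, Finset.sum_sub_distrib] at hprod
  refine le_trans ?_ (mul_le_mul_of_nonneg_left hprod (Real.exp_pos 1).le)
  rw [← Real.exp_add]
  exact Real.one_le_exp (by linarith)

end Path

variable [NeZero n₀]

/-! ### The law of the process -/

section Law

variable {p : PMF (Fin K)} {g₀ : Fin n₀ → Fin K} {q : ℝ} {hq0 : 0 ≤ q} {hq1 : q ≤ 1}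

lemma isGrown_and_isTransition_of_mem_support (h : ℕ → Homophily)
    (hp0 : ∀ k ∈ p.support, ∃ i, g₀ i = k) (hp1 : ∀ k, ∃ i, g₀ i ≠ k) :
    ∀ (T : ℕ), ∀ G ∈ (law p q hq0 hq1 h g₀ T).support, (G (Fin.last T)).IsGrown g₀ T ∧
      ∀ t : Fin T, IsTransition g₀ t (G t.castSucc) (G t.succ)
  | 0, G, hG => by
    rw [law, PMF.mem_support_pure_iff] at hG
    subst hG
    exact ⟨Graph.isGrown_initial g₀, fun t => t.elim0⟩
  | T + 1, H, hH => by
    rw [law, PMF.mem_support_bind_iff] at hH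
    obtain ⟨G, hG, hH⟩ := hH
    obtain ⟨G', hG', rfl⟩ := (PMF.mem_support_map_iff _ _ _).1 hH
    obtain ⟨ih1, ih2⟩ := isGrown_and_isTransition_of_mem_support h hp0 hp1 T G hG
    have tr := isTransition_of_mem_support (h (T + 1)) hp0 hp1 ih1 hG'
    refine ⟨?_, fun t => ?_⟩
    · rw [Fin.snoc_last]
      exact tr.grown
    · refine Fin.lastCases ?_ (fun s => ?_) t
      · rw [Fin.snoc_castSucc, Fin.succ_last, Fin.snoc_last]
        exact tr
      · rw [Fin.snoc_castSucc, Fin.succ_castSucc, Fin.snoc_castSucc]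
        exact ih2 s

/-- Iterated conditioning: since `m t` does not depend on the past, the last factor can be
integrated out first and pulled from the expectation. -/
lemma expect_law_prod_le (h : ℕ → Homophily)
    (hp0 : ∀ k ∈ p.support, ∃ i, g₀ i = k) (hp1 : ∀ k, ∃ i, g₀ i ≠ k)
    (f : ℕ → Graph K n₀ → Graph K n₀ → ℝ≥0∞) (m : ℕ → ℝ≥0∞)
    (hf : ∀ t G, G.IsGrown g₀ t → (step p q hq0 hq1 (h (t + 1)) G).expect (f t G) ≤ m t) :
    ∀ T : ℕ, ((law p q hq0 hq1 h g₀ T).expect fun G =>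
      ∏ t : Fin T, f t (G t.castSucc) (G t.succ)) ≤ ∏ t ∈ Finset.range T, m t
  | 0 => by simp [PMF.expect_const]
  | T + 1 => by
    rw [law, PMF.expect_bind, Finset.prod_range_succ]
    simp only [PMF.expect_map, Fin.prod_univ_castSucc, Fin.succ_castSucc, Fin.snoc_castSucc,
      Fin.succ_last, Fin.snoc_last, Fin.val_castSucc, Fin.val_last, PMF.expect_const_mul]
    calc _ ≤ (law p q hq0 hq1 h g₀ T).expect fun G =>
          (∏ t : Fin T, f t (G t.castSucc) (G t.succ)) * m T :=
        PMF.expect_mono _ fun G hG => by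
          gcongr
          exact hf T _ (isGrown_and_isTransition_of_mem_support h hp0 hp1 T G hG).1
      _ ≤ _ := by
        rw [PMF.expect_mul_const]
        gcongr
        exact expect_law_prod_le h hp0 hp1 f m hf T

end Law

/-! ### Exponential bound for the error probability and its limit. -/

section Consistency

variable {p : PMF (Fin K)} {g₀ : Fin n₀ → Fin K} {q : ℝ} {hq0 : 0 ≤ q} {hq1 : q ≤ 1}

/-- The constant `1 / 4` combines a factor `1 / 2` from the Hellinger bound with another from
`le_sum_sq_sub_of_jumps`. -/
lemma expect_prod_cellWeight_le (hp0 : ∀ k ∈ p.support, ∃ i, g₀ i = k)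
    (hp1 : ∀ k, ∃ i, g₀ i ≠ k) {r : ℝ} (hr : ∀ k, (p k).toReal ≤ r) (hr1 : r ≤ 1)
    (h₁ h₂ : Homophily) {N : ℕ} {T τ σ i j : ℕ} (hi : i < N) (hj : j < N)
    (hσ : σ ≤ T) (hτ : τ ≤ T) {L : ℝ} (hL : 0 ≤ L) (hL1 : L ≤ τ) (hL2 : L ≤ (T : ℝ) - τ)
    (hL3 : L ≤ |(σ : ℝ) - τ|) :
    ((law p q hq0 hq1 (changeAt τ h₁ h₂) g₀ T).expect fun G => ∏ t : Fin T,
        ENNReal.ofReal (cellWeight N h₁ h₂ τ σ i j t (G t.castSucc) (G t.succ)))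
      ≤ ENNReal.ofReal (Real.exp (T * √(1 / N)
        - q * (1 - r) / 4 * (L * (√h₁.theta - √h₂.theta) ^ 2))) := by
  have hN : (0 : ℝ) < N := by exact_mod_cast (Nat.zero_le i).trans_lt hi
  refine (expect_law_prod_le (changeAt τ h₁ h₂) hp0 hp1
    (fun t G G' => ENNReal.ofReal (cellWeight N h₁ h₂ τ σ i j t G G')) _
    (fun t G hG => expect_step_weight_le _ hp0 hp1 hr hG (by positivity) ?_ ?_) T).trans ?_
  · rw [div_le_one hN]
    split_ifs
    · exact_mod_cast hi.le
    · exact_mod_cast hj.le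
  · gcongr
    linarith
  rw [← ENNReal.ofReal_prod_of_nonneg fun t _ => (Real.exp_pos _).le, ← Real.exp_sum]
  refine ENNReal.ofReal_le_ofReal (Real.exp_le_exp.2 ?_)
  have sep := le_sum_sq_sub_of_jumps hσ hτ hL hL1 hL2 hL3 (√h₁.theta) (√h₂.theta)
    (√((i : ℝ) / N)) (√((j : ℝ) / N))
  have e : ∀ t : ℕ, √((((if t < σ then i else j : ℕ) : ℝ) + 1) / N
        - ((if t < σ then i else j : ℕ) : ℝ) / N)
      - q * (1 - r) * ((√(changeAt τ h₁ h₂ (t + 1)).theta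
        - √(((if t < σ then i else j : ℕ) : ℝ) / N)) ^ 2 / 2)
      = √(1 / N) - q * (1 - r) / 2 * ((if t < τ then √h₁.theta else √h₂.theta)
        - (if t < σ then √((i : ℝ) / N) else √((j : ℝ) / N))) ^ 2 := fun t => by
    rw [theta_changeAt, ← sub_div, add_sub_cancel_left]
    split_ifs <;> ring
  simp only [e, Finset.sum_sub_distrib, Finset.sum_const, Finset.card_range, nsmul_eq_mul,
    ← Finset.mul_sum]
  have := mul_le_mul_of_nonneg_left sep (mul_nonneg hq0 (sub_nonneg.2 hr1))
  linarith

/-- A non-asymptotic bound for the probability of an error larger than `ε T`. -/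
lemma toOuterMeasure_error_le (hp0 : ∀ k ∈ p.support, ∃ i, g₀ i = k)
    (hp1 : ∀ k, ∃ i, g₀ i ≠ k) {r : ℝ} (hr : ∀ k, (p k).toReal ≤ r) (hr1 : r ≤ 1)
    (h₁ h₂ : Homophily) {N : ℕ} (hN : 0 < N) {c₀ ε : ℝ} (hc0 : 0 < c₀) (hε : 0 < ε)
    {T τ : ℕ} (hT : 0 < T) (hτ : τ ∈ window c₀ T)
    (τhat : (Fin (T + 1) → Graph K n₀) → ℕ) (hτhat : ∀ G, IsChangePointMLE c₀ G (τhat G)) :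
    (law p q hq0 hq1 (changeAt τ h₁ h₂) g₀ T).toOuterMeasure
        {G | ε < |(τhat G : ℝ) - (τ : ℝ)| / (T : ℝ)}
      ≤ ENNReal.ofReal ((T + 1) * (N * (N * (Real.exp 1 * Real.exp (T * √(1 / N)
        - q * (1 - r) / 4 * (min ε c₀ * T * (√h₁.theta - √h₂.theta) ^ 2)))))) := by
  have hT' : (0 : ℝ) < T := by exact_mod_cast hT
  have le_of_mem : ∀ σ ∈ window c₀ T, σ ≤ T := fun σ hσ => by
    have h := hσ.2
    have : (σ : ℝ) ≤ T := by nlinarith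
    exact_mod_cast this
  have hL : 0 ≤ min ε c₀ * T := by positivity
  have hLε : min ε c₀ * T ≤ ε * T := by gcongr; exact min_le_left _ _
  have hLc : min ε c₀ * T ≤ c₀ * T := by gcongr; exact min_le_right _ _
  set S := (Finset.range (T + 1)).filter fun σ : ℕ => ε * T < |(σ : ℝ) - τ| with hS
  set B := ENNReal.ofReal (Real.exp (T * √(1 / N)
    - q * (1 - r) / 4 * (min ε c₀ * T * (√h₁.theta - √h₂.theta) ^ 2))) with hB
  -- The estimate and the maximizing cells depend on the path, so the bound sums over all of their
  -- possible values.
  refine (PMF.toOuterMeasure_le_expect _ (f := fun G => ∑ σ ∈ S, ∑ i ∈ Finset.range N,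
    ∑ j ∈ Finset.range N, ENNReal.ofReal (Real.exp 1) * ∏ t : Fin T,
      ENNReal.ofReal (cellWeight N h₁ h₂ τ σ i j t (G t.castSucc) (G t.succ))) ?_).trans ?_
  · intro G hG hbad
    have hmle := hτhat G
    obtain ⟨i, hi, j, hj, hij⟩ := exists_cell_one_le_prod
      (isGrown_and_isTransition_of_mem_support _ hp0 hp1 T G hG).2 h₁ h₂ hN (hmle.2 τ hτ)
    have hmem : τhat G ∈ S := Finset.mem_filter.2
      ⟨Finset.mem_range.2 (Nat.lt_succ_of_le (le_of_mem _ hmle.1)), (lt_div_iff₀ hT').1 hbad⟩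
    refine hij.trans (le_trans ?_ (Finset.single_le_sum (fun _ _ => zero_le) hmem))
    refine le_trans ?_ (Finset.single_le_sum (fun _ _ => zero_le) hi)
    exact Finset.single_le_sum (f := fun j => ENNReal.ofReal (Real.exp 1) * ∏ t : Fin T,
      ENNReal.ofReal (cellWeight N h₁ h₂ τ (τhat G) i j t (G t.castSucc) (G t.succ)))
      (fun _ _ => zero_le) hj
  · simp only [PMF.expect_finset_sum, PMF.expect_const_mul]
    have hcard : (S.card : ℝ≥0∞) ≤ (T + 1 : ℕ) := by
      exact_mod_cast (Finset.card_filter_le _ _).trans (Finset.card_range _).le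
    calc _ ≤ ∑ σ ∈ S, ∑ i ∈ Finset.range N, ∑ j ∈ Finset.range N,
          ENNReal.ofReal (Real.exp 1) * B := by
          refine Finset.sum_le_sum fun σ hσ => Finset.sum_le_sum fun i hi =>
            Finset.sum_le_sum fun j hj => ?_
          rw [hS, Finset.mem_filter, Finset.mem_range] at hσ
          gcongr
          exact expect_prod_cellWeight_le hp0 hp1 hr hr1 h₁ h₂ (Finset.mem_range.1 hi)
            (Finset.mem_range.1 hj) (by omega) (le_of_mem τ hτ) hL (hLc.trans hτ.1)
            (by have := hτ.2; linarith) (hLε.trans hσ.2.le)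
      _ ≤ ((T + 1 : ℕ) : ℝ≥0∞) * (N * (N * (ENNReal.ofReal (Real.exp 1) * B))) := by
          simp only [Finset.sum_const, Finset.card_range, nsmul_eq_mul]
          gcongr
      _ = _ := by
          rw [hB, ← ENNReal.ofReal_mul (Real.exp_pos 1).le, ← ENNReal.ofReal_natCast N,
            ← ENNReal.ofReal_mul (Nat.cast_nonneg _), ← ENNReal.ofReal_mul (Nat.cast_nonneg _),
            ← ENNReal.ofReal_natCast, ← ENNReal.ofReal_mul (Nat.cast_nonneg _)]
          push_cast
          rfl

lemma tendsto_succ_mul_exp_neg {c : ℝ} (hc : 0 < c) (C : ℝ) :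
    Tendsto (fun T : ℕ => ((T : ℝ) + 1) * (C * Real.exp (-c * T))) atTop (𝓝 0) := by
  have hr : |Real.exp (-c)| < 1 := by
    rw [abs_of_pos (Real.exp_pos _)]
    exact Real.exp_lt_one_iff.2 (by linarith)
  have h1 := tendsto_pow_const_mul_const_pow_of_abs_lt_one 1 hr
  have h0 := tendsto_pow_const_mul_const_pow_of_abs_lt_one 0 hr
  have h := (h1.add h0).const_mul C
  rw [add_zero, mul_zero] at h
  refine h.congr fun T => ?_
  rw [← Real.exp_nat_mul, mul_comm (T : ℝ) (-c)]
  ring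

end Consistency

end KPA

theorem theorem7 {K n₀ : ℕ} [NeZero n₀] (hn₀ : K ≤ n₀)
    (p : PMF (Fin K)) (hp : ∀ k, p k < 1)
    (g₀ : Fin n₀ → Fin K)
    (hg₀ : ∀ k, ((Finset.univ.filter fun i => g₀ i = k).card : ℝ) = (p k).toReal * n₀)
    (q : ℝ) (hq0 : 0 < q) (hq1 : q ≤ 1)
    (h₁ h₂ : KPA.Homophily) (hne : h₁.theta ≠ h₂.theta)
    (c₀ : ℝ) (hc0 : 0 < c₀) (hc1 : c₀ < 1)
    (τhat : (T : ℕ) → (Fin (T + 1) → KPA.Graph K n₀) → ℕ)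
    (hτhat : ∀ (T : ℕ) (G : Fin (T + 1) → KPA.Graph K n₀), (KPA.window c₀ T).Nonempty →
      KPA.IsChangePointMLE c₀ G (τhat T G))
    (ε : ℝ) (hε : 0 < ε) :
    Tendsto
      (fun T : ℕ => ⨆ τ ∈ KPA.window c₀ T,
        (KPA.law p q hq0.le hq1 (KPA.changeAt τ h₁ h₂) g₀ T).toOuterMeasure
          {G | ε < |(τhat T G : ℝ) - (τ : ℝ)| / (T : ℝ)})
      atTop (𝓝 0) := by
  have hn : (0 : ℝ) < n₀ := by exact_mod_cast NeZero.pos n₀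
  have hp' : ∀ k, (p k).toReal < 1 := fun k => by
    rw [← ENNReal.toReal_one]
    exact (ENNReal.toReal_lt_toReal (p.apply_ne_top k) ENNReal.one_ne_top).2 (hp k)
  have hp0 : ∀ k ∈ p.support, ∃ i, g₀ i = k := fun k hk => by
    by_contra! hcon
    have h := hg₀ k
    rw [Finset.filter_false_of_mem fun i _ => hcon i, Finset.card_empty, Nat.cast_zero] at h
    exact (mul_pos (ENNReal.toReal_pos hk (p.apply_ne_top k)) hn).ne h
  have hp1 : ∀ k, ∃ i, g₀ i ≠ k := fun k => by
    by_contra! hcon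
    have h := hg₀ k
    rw [Finset.filter_true_of_mem fun i _ => hcon i, Finset.card_univ, Fintype.card_fin] at h
    nlinarith [hp' k]
  have : Nonempty (Fin K) := ⟨g₀ 0⟩
  -- Finitely many groups: the maximum of the `p k` is still below 1.
  obtain ⟨k₀, hr⟩ := Finite.exists_max fun k => (p k).toReal
  have hr1 := hp' k₀
  set r := (p k₀).toReal
  set δ := (√h₁.theta - √h₂.theta) ^ 2 with hδ
  have hδ0 : 0 < δ := by
    have : √h₁.theta - √h₂.theta ≠ 0 := fun h => hne <|
      (Real.sqrt_inj h₁.theta_pos.le h₂.theta_pos.le).1 (sub_eq_zero.1 h)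
    positivity
  set m := min ε c₀
  have hm : 0 < m := lt_min hε hc0
  -- Half the rate in `toOuterMeasure_error_le`; the other half absorbs the discretization error
  -- once `√(1 / N) ≤ c`, with `N` independent of `T`.
  set c := q * (1 - r) / 8 * (m * δ) with hc
  have hc' : 0 < c := by
    have := sub_pos.2 hr1
    positivity
  obtain ⟨M, hM⟩ := exists_nat_one_div_lt (sq_pos_of_pos hc')
  have hN : √(1 / ((M + 1 : ℕ) : ℝ)) ≤ c := by
    rw [Real.sqrt_le_left hc'.le]
    push_cast
    exact hM.le
  set N := M + 1
  have lim := ENNReal.tendsto_ofReal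
    (KPA.tendsto_succ_mul_exp_neg hc' ((N : ℝ) * (N * Real.exp 1)))
  rw [ENNReal.ofReal_zero] at lim
  refine tendsto_of_tendsto_of_tendsto_of_le_of_le' tendsto_const_nhds lim
    (Eventually.of_forall fun _ => zero_le) ?_
  filter_upwards [eventually_gt_atTop 0] with T hT
  -- An empty window contributes nothing; otherwise `τ` itself shows that the maximizing property of
  -- `τhat` is available.
  refine iSup₂_le fun τ hτ => ?_
  refine (KPA.toOuterMeasure_error_le hp0 hp1 hr hr1.le h₁ h₂ (N := N) M.succ_pos hc0 hε hT hτ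
    (τhat T) fun G => hτhat T G ⟨τ, hτ⟩).trans (ENNReal.ofReal_le_ofReal ?_)
  have hexp : Real.exp (T * √(1 / (N : ℝ)) - q * (1 - r) / 4 * (m * T * δ))
      ≤ Real.exp (-c * T) := by
    refine Real.exp_le_exp.2 ?_
    have := mul_le_mul_of_nonneg_left hN (Nat.cast_nonneg (α := ℝ) T)
    rw [hc] at this ⊢
    linarith
  rw [mul_assoc (N : ℝ), mul_assoc (N : ℝ)]
  gcongr
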